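/- Let $S_1,\dots,S_N:D\to D$, $D\subseteq\mathbb R^d$, be similitudes, $|S_i(x)-S_i(y)|=c_i|x-y|$ with $0<c_i<1$, satisfying the open set condition (there is a non-empty bounded open set $\mathcal O\subseteq D$ such that the sets $S_i(\mathcal O)$ are pairwise disjoint and contained in $\mathcal O$). Assume that the attractor $K$ (the unique non-empty compact $K\subseteq D$ with $K=\bigcup_i S_i(K)$) is connected. Let $\mathcal A=\{1,\dots,N\}$, let $\mathcal W$ be the set of finite words over $\mathcal A$ (including the empty word $\emptyset$) and $\mathcal W^\star=\mathcal A^{\mathbb N}$ the space of infinite words with the product topology. For $w=w_1\cdots w_n\in\mathcal W$ write $|w|=n$, $w^-=w_1\cdots w_{n-1}$ and $S_w=S_{w_1}\circ\cdots\circ S_{w_n}$. For $v,w\in\mathcal W$ put $v\sim w$ if $v=w$, or if $|v|=|w|$, $S_v(K)\cap S_w(K)\ne\emptyset$ and $v^-\neq w^-$. For $v,w\in\mathcal W^\star$ put $v\sim w$ if there is an $n_0$ such that $v|_n\sim w|_n$ for all $n\ge n_0$, where $v|_n$ denotes the word of the first $n$ letters. Assume that (A) $\sim$ is an equivalence relation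 on $\mathcal W$ (hence also on $\mathcal W^\star$). Let $m:\mathcal A\to(0,1)$ with $\sum_{a\in\mathcal A} m(a)=1$, and extend it by $m(w_1\cdots w_n)=m(w_1)\cdots m(w_n)$, $m(\emptyset)=1$. Assume that (B2) for every $w\in\mathcal W$, either $m(w)=m(\tilde w)$ for all $\tilde w\sim w$, or $w^-\sim\tilde w^-$ for all $\tilde w\sim w$. On $\mathcal W$ define the transition probability $$p(v,w)=\frac{m(w)}{\sum_{\hat v\sim v}m(\hat v)}\ \text{ if } w=\hat v i \text{ with } \hat v\sim v,\ i\in\mathcal A,\qquad p(v,w)=0\ \text{ otherwise},$$ the $n$-step transition probabilities $p_0(v,w)=\delta_v(w)$, $p_n(v,w)=\sum_{u\in\mathcal W}p_{n-1}(v,u)p(u,w)$, the Green function $g(v,w)=\sum_{n\ge0}p_n(v,w)$, the Martin kernel $k(v,w)=g(v,w)/g(\emptyset,w)$ and, for coefficients $a(u)>0$ with $\sum_{u\in\mathcal W} a(u)/g(\emptyset,u)<\infty$, the Martin metric $\rho(v,w)=\sum_{u\in\mathcal W}a(u)|k(u,v)-k(u,w)|$. The Martin space $\overline{\mathcal W}$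 is the $\rho$-completion of $\mathcal W$: the set of $\rho$-Cauchy sequences in $\mathcal W$ modulo the relation that identifies $\{v_n\}$ and $\{w_n\}$ when $\lim_n k(u,v_n)=\lim_n k(u,w_n)$ for all $u\in\mathcal W$, with the metric $\rho([\{v_n\}],[\{w_n\}])=\lim_n\rho(v_n,w_n)$. A word is identified with the class of the constant sequence, and the Martin boundary is the metric space $\mathcal M=\overline{\mathcal W}\setminus\mathcal W$. Let $\mathcal M_{\hom}$ be the Martin boundary obtained in the same way from the homogeneous mass distribution $m(a)=1/N$ for all $a\in\mathcal A$ (with any admissible coefficients $a_{\hom}(u)$ for that case). Then $$K\;\cong\;\mathcal W^\star/\!\sim\;\cong\;\mathcal M_{\hom}=\mathcal M,$$ where $\cong$ means "homeomorphic", $\mathcal W^\star/\!\sim$ carries the quotient topology, and the equality means that $\mathcal M_{\hom}$ and $\mathcal M$ consist of the same classes of sequences and have the same topology. In particular $\mathcal M$ is homeomorphic to $K$. -/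

import Mathlib

open Set Filter Topology

noncomputable section

namespace FractalMartin

/-- An iterated function scheme of `N` similitudes `S i : D → D`, `D ⊆ ℝᵈ`.  The maps are total
functions on `ℝᵈ`, but only their values on `D` matter. -/
structure SimilitudeIFS (d N : ℕ) where
  /-- the common domain of the maps -/
  D : Set (EuclideanSpace ℝ (Fin d))
  /-- the maps -/
  S : Fin N → EuclideanSpace ℝ (Fin d) → EuclideanSpace ℝ (Fin d)
  /-- the contraction ratios -/
  c : Fin N → ℝ
  ratio_pos : ∀ i, 0 < c i
  ratio_lt_one : ∀ i, c i < 1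
  mapsTo : ∀ i, MapsTo (S i) D D
  dist_map : ∀ i, ∀ x ∈ D, ∀ y ∈ D, dist (S i x) (S i y) = c i * dist x y

/-- `K` is the attractor: the (unique) non-empty compact subset of `D` with `K = ⋃ᵢ Sᵢ(K)`. -/
def SimilitudeIFS.IsAttractor {d N : ℕ} (F : SimilitudeIFS d N)
    (K : Set (EuclideanSpace ℝ (Fin d))) : Prop :=
  K.Nonempty ∧ IsCompact K ∧ K ⊆ F.D ∧ K = ⋃ i, F.S i '' K

/-- The open set condition. -/
def SimilitudeIFS.OpenSetCondition {d N : ℕ} (F : SimilitudeIFS d N) : Prop :=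
  ∃ O : Set (EuclideanSpace ℝ (Fin d)), O.Nonempty ∧ Bornology.IsBounded O ∧ IsOpen O ∧
    O ⊆ F.D ∧ (∀ i, F.S i '' O ⊆ O) ∧ Pairwise fun i j => Disjoint (F.S i '' O) (F.S j '' O)

/-- Finite words over the alphabet `Fin N`; `[]` is the empty word, `w.dropLast` the parent of `w`,
`w ++ [i]` the word `wi` and `w.length` the length of `w`. -/
abbrev Word (N : ℕ) : Type := List (Fin N)

/-- Infinite words, with the product topology of the discrete alphabet. -/
abbrev InfWord (N : ℕ) : Type := ℕ → Fin N

/-- The restriction `w|ₙ` of an infinite word to its first `n` letters. -/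
def InfWord.restrict {N : ℕ} (w : InfWord N) (n : ℕ) : Word N :=
  List.ofFn fun i : Fin n => w i

/-- `S_w = S_{w₁} ∘ ⋯ ∘ S_{wₙ}`, with `S_∅ = id`. -/
def SimilitudeIFS.wordMap {d N : ℕ} (F : SimilitudeIFS d N) :
    Word N → EuclideanSpace ℝ (Fin d) → EuclideanSpace ℝ (Fin d)
  | [] => id
  | i :: w => F.S i ∘ F.wordMap w

/-- The relation `v ∼ w` on finite words. -/
def SimilitudeIFS.Sim {d N : ℕ} (F : SimilitudeIFS d N) (K : Set (EuclideanSpace ℝ (Fin d)))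
    (v w : Word N) : Prop :=
  v = w ∨ (v.length = w.length ∧ (F.wordMap v '' K ∩ F.wordMap w '' K).Nonempty ∧
    v.dropLast ≠ w.dropLast)

/-- The extension of a relation on finite words to infinite words. -/
def InfSim {N : ℕ} (r : Word N → Word N → Prop) (v w : InfWord N) : Prop :=
  ∃ n₀ : ℕ, ∀ n ≥ n₀, r (v.restrict n) (w.restrict n)

/-- If `∼` is an equivalence relation on finite words, so is its extension to infinite words. -/
def infSetoid {N : ℕ} (r : Word N → Word N → Prop) (hr : Equivalence r) :
    Setoid (InfWord N) where
  r := InfSim r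
  iseqv :=
    { refl := fun _ => ⟨0, fun _ _ => hr.refl _⟩
      symm := fun ⟨n₀, h⟩ => ⟨n₀, fun n hn => hr.symm (h n hn)⟩
      trans := fun ⟨n₀, h⟩ ⟨n₁, h'⟩ => ⟨max n₀ n₁, fun n hn =>
        hr.trans (h n (le_trans (le_max_left _ _) hn)) (h' n (le_trans (le_max_right _ _) hn))⟩ }

/-- A mass distribution on the alphabet. -/
def IsMassDistribution {N : ℕ} (m : Fin N → ℝ) : Prop :=
  (∀ a, 0 < m a ∧ m a < 1) ∧ ∑ a, m a = 1

/-- The homogeneous mass distribution. -/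
def homMass (N : ℕ) : Fin N → ℝ := fun _ => 1 / (N : ℝ)

/-- The mass `m(w) = m(w₁) ⋯ m(wₙ)` of a word. -/
def wordMass {N : ℕ} (m : Fin N → ℝ) (w : Word N) : ℝ := (w.map m).prod

/-- Condition (B2). -/
def ConditionB2 {N : ℕ} (r : Word N → Word N → Prop) (m : Fin N → ℝ) : Prop :=
  ∀ w : Word N, (∀ w', r w' w → wordMass m w = wordMass m w') ∨
    (∀ w', r w' w → r w.dropLast w'.dropLast)

open Classical in
/-- The transition probability `p(v, w)`.  The denominator is a finite sum when `r` relates only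
words of the same length. -/
def transProb {N : ℕ} (r : Word N → Word N → Prop) (m : Fin N → ℝ) (v w : Word N) : ℝ :=
  if ∃ v' i, r v' v ∧ w = v' ++ [i] then
    wordMass m w / ∑' v' : {v' : Word N // r v' v}, wordMass m v'.1
  else 0

/-- The `n`-step transition probability `pₙ(v, w)`. -/
def stepProb {N : ℕ} (r : Word N → Word N → Prop) (m : Fin N → ℝ) : ℕ → Word N → Word N → ℝ
  | 0 => fun v w => if v = w then 1 else 0
  | n + 1 => fun v w => ∑' u : Word N, stepProb r m n v u * transProb r m u w

/-- The Green function; at most the term `n = |w| - |v|` is non-zero. -/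
def green {N : ℕ} (r : Word N → Word N → Prop) (m : Fin N → ℝ) (v w : Word N) : ℝ :=
  ∑' n : ℕ, stepProb r m n v w

/-- The Martin kernel. -/
def martinKernel {N : ℕ} (r : Word N → Word N → Prop) (m : Fin N → ℝ) (v w : Word N) : ℝ :=
  green r m v w / green r m [] w

/-- The admissible coefficients `a(u)` in the Martin metric. -/
def IsMartinWeight {N : ℕ} (r : Word N → Word N → Prop) (m : Fin N → ℝ) (a : Word N → ℝ) : Prop :=
  (∀ u, 0 < a u) ∧ Summable fun u => a u / green r m [] u

/-- The Martin metric `ρ` on words. -/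
def martinDist {N : ℕ} (r : Word N → Word N → Prop) (m : Fin N → ℝ) (a : Word N → ℝ)
    (v w : Word N) : ℝ :=
  ∑' u : Word N, a u * |martinKernel r m u v - martinKernel r m u w|

/-- The `ρ`-Cauchy sequences of words. -/
def martinCauchy {N : ℕ} (r : Word N → Word N → Prop) (m : Fin N → ℝ) (a : Word N → ℝ) :
    Set (ℕ → Word N) :=
  {s | ∀ ε > 0, ∃ n₀ : ℕ, ∀ i ≥ n₀, ∀ j ≥ n₀, martinDist r m a (s i) (s j) < ε}

/-- Two sequences of words are equivalent if, for each `u`, the kernels `k(u, ·)` have the same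
limit along them. -/
def MartinEquiv {N : ℕ} (r : Word N → Word N → Prop) (m : Fin N → ℝ) (s t : ℕ → Word N) : Prop :=
  ∀ u : Word N, ∃ l : ℝ, Tendsto (fun n => martinKernel r m u (s n)) atTop (𝓝 l) ∧
    Tendsto (fun n => martinKernel r m u (t n)) atTop (𝓝 l)

/-- The class of a `ρ`-Cauchy sequence. -/
def martinClass {N : ℕ} (r : Word N → Word N → Prop) (m : Fin N → ℝ) (a : Word N → ℝ)
    (s : ℕ → Word N) : Set (ℕ → Word N) :=
  {t | t ∈ martinCauchy r m a ∧ MartinEquiv r m s t}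

/-- The Martin space, i.e. the `ρ`-completion of the word space, as the set of all equivalence
classes of `ρ`-Cauchy sequences. -/
def martinSpace {N : ℕ} (r : Word N → Word N → Prop) (m : Fin N → ℝ) (a : Word N → ℝ) :
    Set (Set (ℕ → Word N)) :=
  martinClass r m a '' martinCauchy r m a

/-- The Martin boundary as a set: the Martin space without the points of the word space, where a
word is identified with the class of the constant sequence. -/
def martinBoundarySet {N : ℕ} (r : Word N → Word N → Prop) (m : Fin N → ℝ) (a : Word N → ℝ) :
    Set (Set (ℕ → Word N)) :=
  martinSpace r m a \ range fun w : Word N => martinClass r m a fun _ => w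

/-- The Martin boundary as a type. -/
def MartinBoundary {N : ℕ} (r : Word N → Word N → Prop) (m : Fin N → ℝ) (a : Word N → ℝ) : Type :=
  {ξ : Set (ℕ → Word N) // ξ ∈ martinBoundarySet r m a}

/-- The ball `{ζ | ρ(ξ, ζ) < ε}` in the Martin boundary for the extended metric
`ρ([s], [t]) = lim ρ(sₙ, tₙ)`. -/
def martinBall {N : ℕ} (r : Word N → Word N → Prop) (m : Fin N → ℝ) (a : Word N → ℝ)
    (ξ : MartinBoundary r m a) (ε : ℝ) : Set (MartinBoundary r m a) :=
  {ζ | ∃ s ∈ ξ.1, ∃ t ∈ ζ.1, ∃ l < ε,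
    Tendsto (fun n => martinDist r m a (s n) (t n)) atTop (𝓝 l)}

/-- The topology of the extended metric `ρ` on the Martin boundary. -/
instance {N : ℕ} (r : Word N → Word N → Prop) (m : Fin N → ℝ) (a : Word N → ℝ) :
    TopologicalSpace (MartinBoundary r m a) :=
  TopologicalSpace.generateFrom {U | ∃ ξ, ∃ ε > 0, U = martinBall r m a ξ ε}

end FractalMartin

end

/-!
Everything rests on a dichotomy for the classes of `∼` (`SimilitudeIFS.isAdmissible_sim`): the
parents of the members of a class are either pairwise equivalent or all siblings.

The walk started at `∅` hits `w` with probability `m(w)`, so `k(v, ·)` satisfies a mean value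
property: its value at `wi` is the mean of its values over the class of `w`, weighted by mass
(`martinKernel_append`).  By the dichotomy this mean is taken over one common value or over
grandchildren of a single word, and in the second case the weights are bounded below.  Hence the
oscillation of `k(v, ·)` over the descendants of a word decays geometrically in the length of that
word (`exists_martinKernel_oscillation`), and `k(v, ·)` extends continuously to the infinite words
(`boundaryKernel`); the extension is invariant under `∼`.

On the other hand `k(u, w) ≠ 0` forces the cells `S_u(K)` and `S_w(K)` to be close
(`SimilitudeIFS.exists_dist_le_of_martinKernel_ne_zero`), while at every level some `u` has
`k(u, w) ≠ 0`.  The limit kernels therefore determine the point of `K` coded by an infinite word, and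
the coding map identifies `K` with `𝒲⋆/∼`.

A `ρ`-Cauchy sequence converges to a boundary point if and only if the lengths of its words tend to
infinity and their cells shrink to a point of `K`
(`SimilitudeIFS.mem_martinClass_restrict_iff_cell`).  This description involves neither `m` nor the
coefficients of the metric, so the boundaries for `m` and for the homogeneous distribution consist
of the same classes.  Finally `𝒲⋆/∼ → 𝓜` is a continuous bijection from a compact space to a
Hausdorff space, for either distribution, and thus a homeomorphism.
-/

namespace FractalMartin

/-! ### Equivalence classes of words -/

variable {N : ℕ} {r : Word N → Word N → Prop} {m : Fin N → ℝ}

/-- The combinatorial content of condition (A): an equivalence relation between words of equal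
length such that the parents of the members of a class are either all equivalent to one another,
or all children of one and the same word. -/
structure IsAdmissible (r : Word N → Word N → Prop) : Prop where
  equiv : Equivalence r
  length_eq : ∀ {v w}, r v w → v.length = w.length
  dichotomy : ∀ w, (∀ u, r u w → r u.dropLast w.dropLast) ∨
    (∀ u, r u w → u.dropLast.dropLast = w.dropLast.dropLast)

/-- The finite set of words of length `n`. -/
noncomputable def wordsOfLength (N n : ℕ) : Finset (Word N) :=
  (List.finite_length_eq (Fin N) n).toFinset

@[simp] lemma mem_wordsOfLength {n : ℕ} {w : Word N} : w ∈ wordsOfLength N n ↔ w.length = n := by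
  simp [wordsOfLength]

open Classical in
/-- The class of `w` as a finite set.  Only words of the length of `w` are collected, which is no
restriction when `r` is admissible (`mem_simClass`). -/
noncomputable def simClass (r : Word N → Word N → Prop) (w : Word N) : Finset (Word N) :=
  (wordsOfLength N w.length).filter fun u => r u w

/-- The total mass of the class of `w`, the denominator of the transition probabilities. -/
noncomputable def classMass (r : Word N → Word N → Prop) (m : Fin N → ℝ) (w : Word N) : ℝ :=
  ∑ u ∈ simClass r w, wordMass m u

lemma mem_simClass (hr : IsAdmissible r) {u w : Word N} : u ∈ simClass r w ↔ r u w := by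
  simp only [simClass, Finset.mem_filter, mem_wordsOfLength, and_iff_right_iff_imp]
  exact hr.length_eq

lemma self_mem_simClass (hr : IsAdmissible r) (w : Word N) : w ∈ simClass r w :=
  (mem_simClass hr).2 (hr.equiv.refl w)

lemma simClass_congr (hr : IsAdmissible r) {v w : Word N} (h : r v w) :
    simClass r v = simClass r w := by
  ext u
  rw [mem_simClass hr, mem_simClass hr]
  exact ⟨fun h' => hr.equiv.trans h' h, fun h' => hr.equiv.trans h' (hr.equiv.symm h)⟩

/-! ### The Green function and the Martin kernel -/

lemma wordMass_append (m : Fin N → ℝ) (v w : Word N) :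
    wordMass m (v ++ w) = wordMass m v * wordMass m w := by
  simp [wordMass]

@[simp] lemma wordMass_nil (m : Fin N → ℝ) : wordMass m [] = 1 := by simp [wordMass]

@[simp] lemma wordMass_cons (m : Fin N → ℝ) (a : Fin N) (w : Word N) :
    wordMass m (a :: w) = m a * wordMass m w := by simp [wordMass]

lemma wordMass_pos (hm : IsMassDistribution m) (w : Word N) : 0 < wordMass m w := by
  induction w with
  | nil => simp
  | cons a w ih => simpa using mul_pos (hm.1 a).1 ih

lemma classMass_pos (hr : IsAdmissible r) (hm : IsMassDistribution m) (w : Word N) :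
    0 < classMass r m w :=
  Finset.sum_pos (fun u _ => wordMass_pos hm u) ⟨w, self_mem_simClass hr w⟩

lemma tsum_class (hr : IsAdmissible r) (v : Word N) :
    ∑' v' : {v' : Word N // r v' v}, wordMass m v'.1 = classMass r m v := by
  rw [classMass, ← Finset.tsum_subtype]
  have : {v' : Word N | r v' v} = {v' | v' ∈ simClass r v} := by
    ext u; exact (mem_simClass hr).symm
  exact congrArg (fun s : Set (Word N) => ∑' x : s, wordMass m x.1) this

open Classical in
lemma transProb_append (hr : IsAdmissible r) (v w : Word N) (i : Fin N) :
    transProb r m v (w ++ [i]) =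
      if v ∈ simClass r w then wordMass m (w ++ [i]) / classMass r m w else 0 := by
  have h1 : (∃ v' j, r v' v ∧ w ++ [i] = v' ++ [j]) ↔ v ∈ simClass r w := by
    rw [mem_simClass hr]
    constructor
    · rintro ⟨v', j, h, e⟩
      obtain ⟨rfl, -⟩ := List.append_inj' e rfl
      exact hr.equiv.symm h
    · exact fun h => ⟨w, i, hr.equiv.symm h, rfl⟩
  rw [transProb, tsum_class hr]
  by_cases h : v ∈ simClass r w
  · rw [if_pos (h1.2 h), if_pos h, classMass, classMass,
      simClass_congr hr ((mem_simClass hr).1 h)]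
  · rw [if_neg (mt h1.1 h), if_neg h]

lemma transProb_nil (v : Word N) : transProb r m v [] = 0 := by
  simp [transProb]

lemma stepProb_succ_append (hr : IsAdmissible r) (n : ℕ) (v w : Word N) (i : Fin N) :
    stepProb r m (n + 1) v (w ++ [i]) =
      wordMass m (w ++ [i]) / classMass r m w * ∑ u ∈ simClass r w, stepProb r m n v u := by
  classical
  simp only [stepProb, transProb_append hr, mul_ite, mul_zero]
  rw [tsum_eq_sum (s := simClass r w) (fun u hu => if_neg hu), Finset.mul_sum]
  refine Finset.sum_congr rfl fun u hu => ?_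
  rw [if_pos hu, mul_comm]

lemma stepProb_eq_zero (hr : IsAdmissible r) (n : ℕ) (v w : Word N)
    (h : w.length ≠ v.length + n) : stepProb r m n v w = 0 := by
  induction n generalizing w with
  | zero =>
    have : v ≠ w := fun e => h (by simp [e])
    simp [stepProb, this]
  | succ n ih =>
    rcases List.eq_nil_or_concat' w with rfl | ⟨w, i, rfl⟩
    · simp [stepProb, transProb_nil]
    · rw [stepProb_succ_append hr, Finset.sum_eq_zero, mul_zero]
      intro u hu
      have := hr.length_eq ((mem_simClass hr).1 hu)
      exact ih u (by simp at h; omega)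

lemma green_eq_stepProb (hr : IsAdmissible r) {n : ℕ} {v w : Word N}
    (h : w.length = v.length + n) : green r m v w = stepProb r m n v w :=
  tsum_eq_single n fun k hk => stepProb_eq_zero hr k v w (by omega)

open Classical in
lemma green_of_length_le (hr : IsAdmissible r) {v w : Word N} (h : w.length ≤ v.length) :
    green r m v w = if v = w then 1 else 0 := by
  by_cases h' : w.length = v.length
  · rw [green_eq_stepProb hr (n := 0) (by simpa using h')]
    simp [stepProb]
  · rw [if_neg (by rintro rfl; exact h' rfl), green]
    exact (tsum_congr fun n => stepProb_eq_zero hr n v w (by omega)).trans tsum_zero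

lemma green_append (hr : IsAdmissible r) {v w : Word N} (h : v.length ≤ w.length) (i : Fin N) :
    green r m v (w ++ [i]) =
      wordMass m (w ++ [i]) / classMass r m w * ∑ u ∈ simClass r w, green r m v u := by
  obtain ⟨n, hn⟩ := Nat.exists_eq_add_of_le h
  rw [green_eq_stepProb hr (n := n + 1) (by simp; omega), stepProb_succ_append hr]
  congr 1
  refine Finset.sum_congr rfl fun u hu => ?_
  rw [green_eq_stepProb hr]
  rw [hr.length_eq ((mem_simClass hr).1 hu), hn]

/-- The walk started at `∅` hits `w` with probability `m(w)`: the masses of the members of a class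
add up to the denominator of the next transition. -/
lemma green_nil (hr : IsAdmissible r) (hm : IsMassDistribution m) (w : Word N) :
    green r m [] w = wordMass m w := by
  induction hn : w.length generalizing w with
  | zero =>
    obtain rfl := List.length_eq_zero_iff.1 hn
    simp [green_of_length_le hr]
  | succ n ih =>
    rcases List.eq_nil_or_concat' w with rfl | ⟨w, i, rfl⟩
    · simp at hn
    · rw [green_append hr (by simp)]
      have : ∑ u ∈ simClass r w, green r m [] u = classMass r m w := by
        refine Finset.sum_congr rfl fun u hu => ih u ?_
        rw [hr.length_eq ((mem_simClass hr).1 hu)]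
        simpa using hn
      rw [this, div_mul_cancel₀ _ (classMass_pos hr hm w).ne']

open Classical in
lemma martinKernel_of_length_le (hr : IsAdmissible r) (hm : IsMassDistribution m) {v w : Word N}
    (h : w.length ≤ v.length) :
    martinKernel r m v w = if v = w then (wordMass m v)⁻¹ else 0 := by
  rw [martinKernel, green_of_length_le hr h, green_nil hr hm]
  split_ifs with e
  · rw [e, one_div]
  · simp

/-- Each value of `k(v, ·)` is the mean, with weights proportional to the mass, of its values over
the class of the parent. -/
lemma martinKernel_append (hr : IsAdmissible r) (hm : IsMassDistribution m) {v w : Word N}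
    (h : v.length ≤ w.length) (i : Fin N) :
    martinKernel r m v (w ++ [i]) =
      ∑ u ∈ simClass r w, wordMass m u / classMass r m w * martinKernel r m v u := by
  have h1 := (wordMass_pos hm (w ++ [i])).ne'
  rw [martinKernel, green_append hr h, green_nil hr hm, mul_div_right_comm, div_right_comm,
    div_self h1, Finset.mul_sum]
  refine Finset.sum_congr rfl fun u _ => ?_
  have h2 := (wordMass_pos hm u).ne'
  rw [martinKernel, green_nil hr hm]
  field_simp

lemma sum_weight (hr : IsAdmissible r) (hm : IsMassDistribution m) (w : Word N) :
    ∑ u ∈ simClass r w, wordMass m u / classMass r m w = 1 := by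
  rw [← Finset.sum_div]
  exact div_self (classMass_pos hr hm w).ne'

lemma weight_nonneg (hr : IsAdmissible r) (hm : IsMassDistribution m) (u w : Word N) :
    0 ≤ wordMass m u / classMass r m w :=
  (div_pos (wordMass_pos hm u) (classMass_pos hr hm w)).le

lemma martinKernel_mem_Icc (hr : IsAdmissible r) (hm : IsMassDistribution m) (v w : Word N) :
    martinKernel r m v w ∈ Icc 0 (wordMass m v)⁻¹ := by
  classical
  have hpos := inv_pos.2 (wordMass_pos hm v)
  induction hn : w.length generalizing w with
  | zero =>
    rw [martinKernel_of_length_le hr hm (by omega)]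
    split_ifs <;> simp [hpos.le]
  | succ n ih =>
    by_cases hv : w.length ≤ v.length
    · rw [martinKernel_of_length_le hr hm hv]
      split_ifs <;> simp [hpos.le]
    rcases List.eq_nil_or_concat' w with rfl | ⟨w, i, rfl⟩
    · simp at hn
    · simp only [List.length_append, List.length_singleton, not_le] at hv hn
      rw [martinKernel_append hr hm (by omega)]
      refine (convex_Icc _ _).sum_mem (fun u _ => weight_nonneg hr hm u w)
        (sum_weight hr hm w) fun u hu => ih u ?_
      rw [hr.length_eq ((mem_simClass hr).1 hu)]
      omega

/-- The walk conditioned to pass through `w` visits every level up to that of `w` exactly once; the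
summand is the probability that it does so in `u`. -/
lemma sum_wordMass_mul_martinKernel (hr : IsAdmissible r) (hm : IsMassDistribution m) {n : ℕ}
    {w : Word N} (h : n ≤ w.length) :
    ∑ u ∈ wordsOfLength N n, wordMass m u * martinKernel r m u w = 1 := by
  classical
  induction hk : w.length - n generalizing w with
  | zero =>
    have hl : w.length = n := by omega
    have h1 := (wordMass_pos hm w).ne'
    rw [Finset.sum_eq_single_of_mem w (by simpa using hl)]
    · rw [martinKernel_of_length_le hr hm le_rfl]; simp [h1]
    · intro u hu hne
      rw [martinKernel_of_length_le hr hm (by simp at hu; omega), if_neg hne, mul_zero]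
  | succ k ih =>
    rcases List.eq_nil_or_concat' w with rfl | ⟨w, i, rfl⟩
    · simp at hk
    · simp only [List.length_append, List.length_singleton] at hk h
      calc ∑ u ∈ wordsOfLength N n, wordMass m u * martinKernel r m u (w ++ [i])
          = ∑ u ∈ wordsOfLength N n, ∑ u' ∈ simClass r w,
              wordMass m u' / classMass r m w * (wordMass m u * martinKernel r m u u') := by
            refine Finset.sum_congr rfl fun u hu => ?_
            rw [martinKernel_append hr hm (by simp at hu; omega), Finset.mul_sum]
            exact Finset.sum_congr rfl fun _ _ => by ring
        _ = ∑ u' ∈ simClass r w, wordMass m u' / classMass r m w := by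
            rw [Finset.sum_comm]
            refine Finset.sum_congr rfl fun u' hu' => ?_
            have hl := hr.length_eq ((mem_simClass hr).1 hu')
            rw [← Finset.mul_sum, ih (by omega) (by omega), mul_one]
        _ = 1 := sum_weight hr hm w

/-- Beyond the level of `v`, the value `k(v, u)` depends only on the class of the parent of `u`. -/
lemma martinKernel_congr (hr : IsAdmissible r) (hm : IsMassDistribution m) {v u w : Word N}
    (hu : v.length < u.length) (h : r u.dropLast w.dropLast) (hl : u.length = w.length) :
    martinKernel r m v u = martinKernel r m v w := by
  rcases List.eq_nil_or_concat' u with rfl | ⟨u, i, rfl⟩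
  · simp at hu
  rcases List.eq_nil_or_concat' w with rfl | ⟨w, j, rfl⟩
  · simp at hl
  simp only [List.length_append, List.length_singleton, List.dropLast_concat] at hu h hl
  rw [martinKernel_append hr hm (by omega), martinKernel_append hr hm (by omega), classMass,
    classMass, simClass_congr hr h]

/-! ### Contraction of the oscillation of the kernel -/

lemma exists_letterMass_lower_bound (hm : IsMassDistribution m) :
    ∃ δ : ℝ, 0 < δ ∧ δ ≤ 1 ∧ ∀ a b, δ ≤ m a * m b := by
  by_cases hN : Nonempty (Fin N)
  · obtain ⟨a, ha⟩ := Finite.exists_min m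
    refine ⟨m a * m a, mul_pos (hm.1 a).1 (hm.1 a).1, ?_, fun b c => ?_⟩
    · exact mul_le_one₀ (hm.1 a).2.le (hm.1 a).1.le (hm.1 a).2.le
    · exact mul_le_mul (ha b) (ha c) (hm.1 a).1.le (hm.1 b).1.le
  · exact ⟨1, one_pos, le_rfl, fun a => (hN ⟨a⟩).elim⟩

/-- A class inside the set of grandchildren of `x` has at most the mass of `x`, so the weight of a
member `xab` in that class is at least `m(a) m(b)`. -/
lemma classMass_le (hr : IsAdmissible r) (hm : IsMassDistribution m) {x : Word N} {w : Word N}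
    (hw : w.length = x.length + 2) (h : ∀ u, r u w → u.dropLast.dropLast = x) :
    classMass r m w ≤ wordMass m x := by
  classical
  have hsub : simClass r w ⊆
      (Finset.univ : Finset (Fin N × Fin N)).image fun p => x ++ [p.1] ++ [p.2] := by
    intro u hu
    rw [mem_simClass hr] at hu
    have hl := hr.length_eq hu
    have hx := h u hu
    rcases List.eq_nil_or_concat' u with rfl | ⟨u, b, rfl⟩
    · simp at hl; omega
    rcases List.eq_nil_or_concat' u with rfl | ⟨u, a, rfl⟩
    · simp at hl; omega
    simp only [List.dropLast_concat] at hx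
    subst hx
    exact Finset.mem_image.2 ⟨(a, b), Finset.mem_univ _, rfl⟩
  refine (Finset.sum_le_sum_of_subset_of_nonneg hsub
    fun u _ _ => (wordMass_pos hm u).le).trans ?_
  refine (Finset.sum_image_le_of_nonneg fun u _ => (wordMass_pos hm _).le).trans ?_
  simp only [wordMass_append, wordMass_cons, wordMass_nil, mul_one, Fintype.sum_prod_type,
    ← Finset.mul_sum, hm.2, le_refl]

/-- One contraction step.  The value at `xabc` is an average over the class of `xab`.  If the parents
of that class are equivalent, it equals the value at `xab`; otherwise the class consists of
grandchildren of `x`, and `xab` itself carries a weight of at least `δ`. -/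
lemma martinKernel_grandchildren_step (hr : IsAdmissible r) (hm : IsMassDistribution m)
    {δ : ℝ} (hδ : ∀ a b, δ ≤ m a * m b) {v x : Word N} (hx : v.length ≤ x.length)
    {lo hi : ℝ} (h : ∀ a b, martinKernel r m v (x ++ [a] ++ [b]) ∈ Icc lo hi) (a b c : Fin N) :
    martinKernel r m v (x ++ [a] ++ [b] ++ [c]) ∈
      Icc (δ * martinKernel r m v (x ++ [a] ++ [b]) + (1 - δ) * lo)
        (δ * martinKernel r m v (x ++ [a] ++ [b]) + (1 - δ) * hi) := by
  set f := martinKernel r m v with hf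
  set w := x ++ [a] ++ [b] with hw
  have hwl : w.length = x.length + 2 := by simp [hw]
  have hδ1 : δ ≤ 1 := (hδ a a).trans
    (mul_le_one₀ (hm.1 a).2.le (hm.1 a).1.le (hm.1 a).2.le)
  have hw' := h a b
  have key : f (w ++ [c]) = ∑ u ∈ simClass r w, wordMass m u / classMass r m w * f u :=
    martinKernel_append hr hm (by omega) c
  rcases hr.dichotomy w with h1 | h1
  · have : f (w ++ [c]) = f w := by
      rw [key, ← one_mul (f w), ← sum_weight hr hm w, Finset.sum_mul]
      refine Finset.sum_congr rfl fun u hu => ?_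
      rw [mem_simClass hr] at hu
      have hl := hr.length_eq hu
      rw [hf, martinKernel_congr hr hm (by omega) (h1 u hu) hl]
    rw [this]
    constructor <;> nlinarith [hw'.1, hw'.2]
  · have hmem : ∀ u ∈ simClass r w, f u ∈ Icc lo hi := by
      intro u hu
      rw [mem_simClass hr] at hu
      have hl := hr.length_eq hu
      have hx := h1 u hu
      rcases List.eq_nil_or_concat' u with rfl | ⟨u, b', rfl⟩
      · simp at hl; omega
      rcases List.eq_nil_or_concat' u with rfl | ⟨u, a', rfl⟩
      · simp at hl; omega
      simp only [hw, List.dropLast_concat] at hx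
      subst hx
      exact h a' b'
    have hcm : classMass r m w ≤ wordMass m x :=
      classMass_le hr hm hwl fun u hu => by simpa [hw] using h1 u hu
    have hlam : δ ≤ wordMass m w / classMass r m w := by
      rw [le_div_iff₀ (classMass_pos hr hm w)]
      have h2 : wordMass m w = wordMass m x * (m a * m b) := by
        simp [hw, wordMass_append]
      rw [h2]
      calc δ * classMass r m w ≤ m a * m b * classMass r m w :=
            mul_le_mul_of_nonneg_right (hδ a b) (classMass_pos hr hm w).le
        _ ≤ m a * m b * wordMass m x :=
            mul_le_mul_of_nonneg_left hcm (mul_pos (hm.1 a).1 (hm.1 b).1).le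
        _ = _ := mul_comm _ _
    have hself := self_mem_simClass hr w
    have hsplit := Finset.add_sum_erase (simClass r w)
      (fun u => wordMass m u / classMass r m w * f u) hself
    have hsplit1 := Finset.add_sum_erase (simClass r w)
      (fun u => wordMass m u / classMass r m w) hself
    rw [sum_weight hr hm w] at hsplit1
    rw [← key] at hsplit
    have hlo : (∑ u ∈ (simClass r w).erase w, wordMass m u / classMass r m w) * lo ≤
        ∑ u ∈ (simClass r w).erase w, wordMass m u / classMass r m w * f u := by
      rw [Finset.sum_mul]
      exact Finset.sum_le_sum fun u hu => mul_le_mul_of_nonneg_left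
        (hmem u (Finset.mem_of_mem_erase hu)).1 (weight_nonneg hr hm u w)
    have hhi : ∑ u ∈ (simClass r w).erase w, wordMass m u / classMass r m w * f u ≤
        (∑ u ∈ (simClass r w).erase w, wordMass m u / classMass r m w) * hi := by
      rw [Finset.sum_mul]
      exact Finset.sum_le_sum fun u hu => mul_le_mul_of_nonneg_left
        (hmem u (Finset.mem_of_mem_erase hu)).2 (weight_nonneg hr hm u w)
    have he : ∑ u ∈ (simClass r w).erase w, wordMass m u / classMass r m w =
        1 - wordMass m w / classMass r m w := by linarith
    rw [he] at hlo hhi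
    constructor
    · nlinarith [mul_nonneg (sub_nonneg.2 hlam) (sub_nonneg.2 hw'.1)]
    · nlinarith [mul_nonneg (sub_nonneg.2 hlam) (sub_nonneg.2 hw'.2)]

lemma martinKernel_descendants_mem_Icc (hr : IsAdmissible r) (hm : IsMassDistribution m)
    {v x : Word N} (hx : v.length ≤ x.length)
    {lo hi : ℝ} (h : ∀ a b, martinKernel r m v (x ++ [a] ++ [b]) ∈ Icc lo hi) (y : Word N)
    (hy : 2 ≤ y.length) : martinKernel r m v (x ++ y) ∈ Icc lo hi := by
  obtain ⟨a, y, rfl⟩ := List.exists_cons_of_length_pos (show 0 < y.length by omega)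
  induction y generalizing x a with
  | nil => simp at hy
  | cons b y ih =>
    rcases y with _ | ⟨c, y⟩
    · simpa using h a b
    · have := ih (x := x ++ [a]) (by simp; omega) (fun b c => ?_) b (by simp)
      · simpa using this
      · obtain ⟨δ, hδ0, hδ1, hδ⟩ := exists_letterMass_lower_bound hm
        have h1 := martinKernel_grandchildren_step hr hm hδ hx h a b c
        have h2 := h a b
        constructor <;> nlinarith [h1.1, h1.2, h2.1, h2.2]

/-- The values of `k(v, ·)` at the grandchildren of a word `n` levels below `v` lie in an interval of
length `(1 - δ)ⁿ / m(v)`. -/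
lemma exists_grandchildren_bounds (hr : IsAdmissible r) (hm : IsMassDistribution m)
    {δ : ℝ} (hδ : ∀ a b, δ ≤ m a * m b) (v : Word N) (n : ℕ) (x : Word N)
    (hx : x.length = v.length + n) :
    ∃ lo hi, (∀ a b, martinKernel r m v (x ++ [a] ++ [b]) ∈ Icc lo hi) ∧
      hi - lo = (1 - δ) ^ n * (wordMass m v)⁻¹ := by
  induction n generalizing x with
  | zero => exact ⟨0, (wordMass m v)⁻¹, fun a b => martinKernel_mem_Icc hr hm _ _, by simp⟩
  | succ n ih =>
    rcases List.eq_nil_or_concat' x with rfl | ⟨x, a, rfl⟩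
    · simp at hx
    simp only [List.length_append, List.length_singleton] at hx
    obtain ⟨lo, hi, h, hlen⟩ := ih x (by omega)
    -- The value at `xab` does not depend on `b`, so the step gives one interval for all of `xabc`.
    set t := martinKernel r m v (x ++ [a] ++ [a])
    refine ⟨δ * t + (1 - δ) * lo, δ * t + (1 - δ) * hi, fun b c => ?_, ?_⟩
    · have := martinKernel_grandchildren_step hr hm hδ (by omega) h a b c
      rwa [martinKernel_congr (w := x ++ [a] ++ [a]) hr hm (by simp; omega)
        (by simpa using hr.equiv.refl _) (by simp)] at this
    · rw [pow_succ, mul_assoc, mul_comm (1 - δ) (wordMass m v)⁻¹, ← mul_assoc, ← hlen]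
      ring

/-- The oscillation of `k(v, ·)` over the descendants of a word decays geometrically in the length of
that word.  Children are excluded because the bounds above concern grandchildren. -/
lemma exists_martinKernel_oscillation (hr : IsAdmissible r) (hm : IsMassDistribution m) :
    ∃ θ : ℝ, 0 ≤ θ ∧ θ < 1 ∧ ∀ (v : Word N) (n : ℕ) (x : Word N), x.length = v.length + n →
      ∀ y z : Word N, 2 ≤ y.length → 2 ≤ z.length →
        |martinKernel r m v (x ++ y) - martinKernel r m v (x ++ z)| ≤
          θ ^ n * (wordMass m v)⁻¹ := by
  obtain ⟨δ, hδ0, hδ1, hδ⟩ := exists_letterMass_lower_bound hm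
  refine ⟨1 - δ, by linarith, by linarith, fun v n x hx y z hy hz => ?_⟩
  obtain ⟨lo, hi, h, hlen⟩ := exists_grandchildren_bounds hr hm hδ v n x hx
  have h1 := martinKernel_descendants_mem_Icc hr hm (by omega) h y hy
  have h2 := martinKernel_descendants_mem_Icc hr hm (by omega) h z hz
  rw [← hlen, abs_le]
  constructor <;> linarith [h1.1, h1.2, h2.1, h2.2]

/-- Long words with a long common prefix have nearly the same value of `k(v, ·)`. -/
lemma exists_take_martinKernel_lt (hr : IsAdmissible r) (hm : IsMassDistribution m) (v : Word N)
    {ε : ℝ} (hε : 0 < ε) :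
    ∃ L : ℕ, ∀ s t : Word N, L ≤ s.length → L ≤ t.length → s.take L = t.take L →
      |martinKernel r m v s - martinKernel r m v t| < ε := by
  obtain ⟨θ, h0, h1, h⟩ := exists_martinKernel_oscillation hr hm
  have hlim : Tendsto (fun n : ℕ => θ ^ n * (wordMass m v)⁻¹) atTop (𝓝 (0 * (wordMass m v)⁻¹)) :=
    (tendsto_pow_atTop_nhds_zero_of_lt_one h0 h1).mul_const _
  rw [zero_mul] at hlim
  obtain ⟨n, hn⟩ := (hlim.eventually (gt_mem_nhds hε)).exists
  refine ⟨v.length + n + 2, fun s t hs ht hst => lt_of_le_of_lt ?_ hn⟩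
  have hst' : s.take (v.length + n) = t.take (v.length + n) := by
    have := congrArg (List.take (v.length + n)) hst
    simpa [List.take_take] using this
  have := h v n (s.take (v.length + n)) (by simp; omega) (s.drop (v.length + n))
    (t.drop (v.length + n)) (by simp; omega) (by simp; omega)
  rw [List.take_append_drop, hst', List.take_append_drop] at this
  exact this

/-! ### Prefixes of infinite words -/

namespace InfWord

@[simp] lemma length_restrict (w : InfWord N) (n : ℕ) : (w.restrict n).length = n := by
  simp [restrict]

lemma restrict_succ (w : InfWord N) (n : ℕ) : w.restrict (n + 1) = w.restrict n ++ [w n] := by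
  rw [restrict, List.ofFn_succ']
  simp [restrict]

lemma getElem_restrict (w : InfWord N) {n i : ℕ} (h : i < (w.restrict n).length) :
    (w.restrict n)[i] = w i := by
  simp [restrict]

lemma take_restrict (w : InfWord N) {k n : ℕ} (h : k ≤ n) :
    (w.restrict n).take k = w.restrict k := by
  refine List.ext_getElem (by simpa using h) fun i _ _ => ?_
  rw [List.getElem_take, getElem_restrict, getElem_restrict]

lemma restrict_eq_restrict {v w : InfWord N} {n : ℕ} :
    v.restrict n = w.restrict n ↔ ∀ i < n, v i = w i := by
  constructor
  · intro h i hi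
    have := List.getElem_of_eq h (i := i) (by simpa using hi)
    simpa only [getElem_restrict] using this
  · intro h
    refine List.ext_getElem (by simp) fun i hi _ => ?_
    rw [getElem_restrict, getElem_restrict]
    exact h i (by simpa using hi)

lemma eventually_restrict_eq (w : InfWord N) (n : ℕ) :
    ∀ᶠ v in 𝓝 w, restrict v n = w.restrict n := by
  have : ∀ᶠ v : InfWord N in 𝓝 w, ∀ i ∈ Finset.range n, v i = w i :=
    (Filter.eventually_all_finset _).2 fun i _ =>
      (continuous_apply i).continuousAt.eventually ((isOpen_discrete {w i}).mem_nhds rfl)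
  filter_upwards [this] with v hv
  exact restrict_eq_restrict.2 fun i hi => hv i (Finset.mem_range.2 hi)

end InfWord

lemma exists_restrict_eq [Nonempty (Fin N)] (t : Word N) :
    ∃ w : InfWord N, w.restrict t.length = t := by
  refine ⟨fun n => t.getD n (Classical.arbitrary _), List.ext_getElem (by simp) fun i _ h => ?_⟩
  rw [InfWord.getElem_restrict, List.getD_eq_getElem _ _ h]

/-! ### The kernel on infinite words -/

/-- The Martin kernel `k(u, w) = lim k(u, w|ₙ)` at an infinite word `w`.  The limit exists for
admissible relations and mass distributions (`tendsto_martinKernel_restrict`). -/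
noncomputable def boundaryKernel (r : Word N → Word N → Prop) (m : Fin N → ℝ) (u : Word N)
    (w : InfWord N) : ℝ :=
  limUnder atTop fun n => martinKernel r m u (w.restrict n)

lemma tendsto_martinKernel_restrict (hr : IsAdmissible r) (hm : IsMassDistribution m)
    (u : Word N) (w : InfWord N) :
    Tendsto (fun n => martinKernel r m u (w.restrict n)) atTop (𝓝 (boundaryKernel r m u w)) := by
  refine CauchySeq.tendsto_limUnder (Metric.cauchySeq_iff.2 fun ε hε => ?_)
  obtain ⟨L, hL⟩ := exists_take_martinKernel_lt hr hm u hε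
  refine ⟨L, fun i hi j hj => hL _ _ (by simpa using hi) (by simpa using hj) ?_⟩
  rw [InfWord.take_restrict _ hi, InfWord.take_restrict _ hj]

lemma exists_abs_martinKernel_sub_boundaryKernel_le (hr : IsAdmissible r)
    (hm : IsMassDistribution m) (u : Word N) {ε : ℝ} (hε : 0 < ε) :
    ∃ L : ℕ, ∀ (t : Word N) (w : InfWord N), L ≤ t.length → t.take L = w.restrict L →
      |martinKernel r m u t - boundaryKernel r m u w| ≤ ε := by
  obtain ⟨L, hL⟩ := exists_take_martinKernel_lt hr hm u hε
  refine ⟨L, fun t w ht htw => ?_⟩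
  refine le_of_tendsto ((tendsto_const_nhds.sub (tendsto_martinKernel_restrict hr hm u w)).abs) ?_
  filter_upwards [eventually_ge_atTop L] with n hn
  exact (hL _ _ ht (by simpa using hn) (by rw [htw, InfWord.take_restrict _ hn])).le

lemma continuous_boundaryKernel (hr : IsAdmissible r) (hm : IsMassDistribution m) (u : Word N) :
    Continuous (boundaryKernel r m u) := by
  refine Metric.continuous_iff'.2 fun w ε hε => ?_
  obtain ⟨L, hL⟩ := exists_abs_martinKernel_sub_boundaryKernel_le hr hm u
    (show 0 < ε / 3 by positivity)
  filter_upwards [w.eventually_restrict_eq L] with v hv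
  have h1 := hL (w.restrict L) w (by simp) (InfWord.take_restrict _ le_rfl)
  have h2 := hL (w.restrict L) v (by simp) (by rw [InfWord.take_restrict _ le_rfl, hv])
  rw [Real.dist_eq, abs_lt]
  rw [abs_le] at h1 h2
  constructor <;> linarith [h1.1, h1.2, h2.1, h2.2]

lemma boundaryKernel_mem_Icc (hr : IsAdmissible r) (hm : IsMassDistribution m) (u : Word N)
    (w : InfWord N) : boundaryKernel r m u w ∈ Icc 0 (wordMass m u)⁻¹ :=
  isClosed_Icc.mem_of_tendsto (tendsto_martinKernel_restrict hr hm u w)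
    (Eventually.of_forall fun _ => martinKernel_mem_Icc hr hm _ _)

lemma sum_wordMass_mul_boundaryKernel (hr : IsAdmissible r) (hm : IsMassDistribution m) (n : ℕ)
    (w : InfWord N) :
    ∑ u ∈ wordsOfLength N n, wordMass m u * boundaryKernel r m u w = 1 := by
  refine tendsto_nhds_unique (tendsto_finsetSum _ fun u _ =>
    (tendsto_martinKernel_restrict hr hm u w).const_mul _) ?_
  refine tendsto_const_nhds.congr' ?_
  filter_upwards [eventually_ge_atTop n] with k hk
  exact (sum_wordMass_mul_martinKernel hr hm (by simpa using hk)).symm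

lemma exists_boundaryKernel_ne_zero (hr : IsAdmissible r) (hm : IsMassDistribution m) (n : ℕ)
    (w : InfWord N) : ∃ u : Word N, u.length = n ∧ boundaryKernel r m u w ≠ 0 := by
  by_contra! h
  have := sum_wordMass_mul_boundaryKernel hr hm n w
  rw [Finset.sum_eq_zero] at this
  · simp at this
  · intro u hu
    rw [h u (by simpa using hu), mul_zero]

lemma boundaryKernel_eq_of_infSim (hr : IsAdmissible r) (hm : IsMassDistribution m) {v w : InfWord N}
    (h : InfSim r v w) (u : Word N) : boundaryKernel r m u v = boundaryKernel r m u w := by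
  obtain ⟨n₀, h⟩ := h
  refine tendsto_nhds_unique_of_eventuallyEq (tendsto_martinKernel_restrict hr hm u v)
    (tendsto_martinKernel_restrict hr hm u w) ?_
  filter_upwards [eventually_ge_atTop (n₀ + 1), eventually_ge_atTop (u.length + 1)] with n hn hu
  obtain ⟨n, rfl⟩ := Nat.exists_eq_add_of_le' (show 1 ≤ n by omega)
  refine martinKernel_congr hr hm (by simp; omega) ?_ (by simp)
  simpa [InfWord.restrict_succ] using h n (by omega)

/-! ### Cells of the attractor -/

namespace SimilitudeIFS

variable {d : ℕ} {F : SimilitudeIFS d N} {K : Set (EuclideanSpace ℝ (Fin d))}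

lemma wordMap_append (F : SimilitudeIFS d N) (v w : Word N) :
    F.wordMap (v ++ w) = F.wordMap v ∘ F.wordMap w := by
  induction v with
  | nil => rfl
  | cons i v ih => rw [List.cons_append, wordMap, ih, wordMap, Function.comp_assoc]

/-- The cell `S_w(K)`. -/
def cell (F : SimilitudeIFS d N) (K : Set (EuclideanSpace ℝ (Fin d))) (w : Word N) :
    Set (EuclideanSpace ℝ (Fin d)) :=
  F.wordMap w '' K

lemma cell_append_subset (hK : F.IsAttractor K) (w : Word N) (i : Fin N) :
    F.cell K (w ++ [i]) ⊆ F.cell K w := by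
  have h : F.S i '' K ⊆ K := by
    conv_rhs => rw [hK.2.2.2]
    exact subset_iUnion (fun i => F.S i '' K) i
  rw [cell, wordMap_append, image_comp]
  exact image_mono h

lemma cell_nonempty (hK : F.IsAttractor K) (w : Word N) : (F.cell K w).Nonempty :=
  hK.1.image _

lemma cell_subset_cell_dropLast (hK : F.IsAttractor K) (w : Word N) :
    F.cell K w ⊆ F.cell K w.dropLast := by
  rcases List.eq_nil_or_concat' w with rfl | ⟨w, i, rfl⟩
  · rfl
  · simpa using cell_append_subset hK w i

lemma exists_dist_wordMap_le (F : SimilitudeIFS d N) :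
    ∃ q : ℝ, 0 ≤ q ∧ q < 1 ∧ ∀ w : Word N, MapsTo (F.wordMap w) F.D F.D ∧
      ∀ x ∈ F.D, ∀ y ∈ F.D, dist (F.wordMap w x) (F.wordMap w y) ≤ q ^ w.length * dist x y := by
  obtain ⟨q, h0, h1, hq⟩ : ∃ q : ℝ, 0 ≤ q ∧ q < 1 ∧ ∀ i, F.c i ≤ q := by
    by_cases hN : Nonempty (Fin N)
    · obtain ⟨i, hi⟩ := Finite.exists_max F.c
      exact ⟨F.c i, (F.ratio_pos i).le, F.ratio_lt_one i, hi⟩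
    · exact ⟨0, le_rfl, one_pos, fun i => (hN ⟨i⟩).elim⟩
  refine ⟨q, h0, h1, fun w => ?_⟩
  induction w with
  | nil => exact ⟨mapsTo_id _, fun x _ y _ => by simp [wordMap]⟩
  | cons i w ih =>
    refine ⟨(F.mapsTo i).comp ih.1, fun x hx y hy => ?_⟩
    rw [wordMap, Function.comp_apply, Function.comp_apply,
      F.dist_map i _ (ih.1 hx) _ (ih.1 hy), List.length_cons, pow_succ', mul_assoc]
    exact mul_le_mul (hq i) (ih.2 x hx y hy) dist_nonneg h0

lemma exists_dist_le_of_mem_cell (hK : F.IsAttractor K) :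
    ∃ q D : ℝ, 0 ≤ q ∧ q < 1 ∧ 0 ≤ D ∧ ∀ w : Word N, ∀ x ∈ F.cell K w, ∀ y ∈ F.cell K w,
      dist x y ≤ q ^ w.length * D := by
  obtain ⟨q, h0, h1, hq⟩ := F.exists_dist_wordMap_le
  refine ⟨q, Metric.diam K, h0, h1, Metric.diam_nonneg, ?_⟩
  rintro w _ ⟨x, hx, rfl⟩ _ ⟨y, hy, rfl⟩
  exact ((hq w).2 x (hK.2.2.1 hx) y (hK.2.2.1 hy)).trans
    (mul_le_mul_of_nonneg_left (Metric.dist_le_diam_of_mem hK.2.1.isBounded hx hy)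
      (pow_nonneg h0 _))

lemma isCompact_cell (hK : F.IsAttractor K) (w : Word N) : IsCompact (F.cell K w) := by
  obtain ⟨q, h0, h1, hq⟩ := F.exists_dist_wordMap_le
  have : LipschitzOnWith (Real.toNNReal (q ^ w.length)) (F.wordMap w) K :=
    LipschitzOnWith.of_dist_le_mul fun x hx y hy => by
      rw [Real.coe_toNNReal _ (pow_nonneg h0 _)]
      exact (hq w).2 x (hK.2.2.1 hx) y (hK.2.2.1 hy)
  exact hK.2.1.image_of_continuousOn this.continuousOn

/-- Parents of distinct equivalent words are distinct with intersecting cells, hence equivalent or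
siblings.  The two cases do not mix within a class, since siblings are never equivalent. -/
lemma isAdmissible_sim (hK : F.IsAttractor K) (hA : Equivalence (F.Sim K)) :
    IsAdmissible (F.Sim K) where
  equiv := hA
  length_eq := by
    rintro v w (rfl | h)
    exacts [rfl, h.1]
  dichotomy := by
    intro w
    have key : ∀ u v, F.Sim K u v → F.Sim K u.dropLast v.dropLast ∨
        (u.dropLast ≠ v.dropLast ∧ u.dropLast.dropLast = v.dropLast.dropLast) := by
      rintro u v (rfl | ⟨hl, hne, hp⟩)
      · exact Or.inl (hA.refl _)
      · by_cases h : u.dropLast.dropLast = v.dropLast.dropLast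
        · exact Or.inr ⟨hp, h⟩
        · exact Or.inl (Or.inr ⟨by simp [hl], hne.mono (inter_subset_inter
            (cell_subset_cell_dropLast hK u) (cell_subset_cell_dropLast hK v)), h⟩)
    have nsib : ∀ u v, u ≠ v → u.dropLast = v.dropLast → ¬ F.Sim K u v := by
      rintro u v hne hp (h | h)
      exacts [hne h, h.2.2 hp]
    by_contra! h
    obtain ⟨⟨u, hu, hu'⟩, v, hv, hv'⟩ := h
    obtain ⟨-, hu2⟩ := (key u w hu).resolve_left hu'
    have hv2 : F.Sim K v.dropLast w.dropLast := (key v w hv).resolve_right fun h => hv' h.2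
    rcases key u v (hA.trans hu (hA.symm hv)) with h | h
    · exact hu' (hA.trans h hv2)
    · exact hv' (h.2.symm.trans hu2)

lemma cell_inter_nonempty_of_sim (hK : F.IsAttractor K) {v w : Word N} (h : F.Sim K v w) :
    (F.cell K v ∩ F.cell K w).Nonempty := by
  rcases h with rfl | h
  · rw [inter_self]; exact cell_nonempty hK v
  · exact h.2.1

/-- If `k(u, w) ≠ 0`, then the cell of `w` is near the cell of `u`: the walk passes from `u` to `w`
through cells of geometrically decreasing size, each of which meets the next. -/
lemma exists_dist_le_of_martinKernel_ne_zero (hK : F.IsAttractor K) (hA : Equivalence (F.Sim K))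
    (hm : IsMassDistribution m) :
    ∃ q C : ℝ, 0 ≤ q ∧ q < 1 ∧ ∀ u w : Word N, u.length ≤ w.length →
      martinKernel (F.Sim K) m u w ≠ 0 → ∀ x ∈ F.cell K u, ∀ y ∈ F.cell K w,
        dist x y ≤ C * q ^ u.length := by
  classical
  have hr := isAdmissible_sim hK hA
  obtain ⟨q, D, h0, h1, hD, hcell⟩ := exists_dist_le_of_mem_cell hK
  have hq : 0 < 1 - q := by linarith
  refine ⟨q, D * (1 + 1 / (1 - q)), h0, h1, fun u w hl hne x hx y hy => ?_⟩
  -- The subtracted term is the part of the geometric series still available to later steps.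
  have key : ∀ y ∈ F.cell K w, dist x y ≤
      D * (1 + 1 / (1 - q)) * q ^ u.length - D / (1 - q) * q ^ w.length := by
    clear hy y
    induction hn : w.length generalizing w with
    | zero =>
      have hlu : u.length = 0 := by omega
      rw [martinKernel_of_length_le hr hm (by omega)] at hne
      obtain rfl : u = w := by by_contra h; simp [h] at hne
      intro y hy
      refine (hcell u x hx y hy).trans (le_of_eq ?_)
      rw [hlu]; field_simp; ring
    | succ n ih =>
      intro y hy
      rcases hl.eq_or_lt with hl | hl
      · rw [martinKernel_of_length_le hr hm (by omega)] at hne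
        obtain rfl : u = w := by by_contra h; simp [h] at hne
        refine (hcell u x hx y hy).trans (le_of_eq ?_)
        rw [← hn]; field_simp; ring
      rcases List.eq_nil_or_concat' w with rfl | ⟨w, i, rfl⟩
      · simp at hn
      simp only [List.length_append, List.length_singleton, Nat.add_right_cancel_iff] at hl hn
      rw [martinKernel_append hr hm (by omega)] at hne
      obtain ⟨w', hw', hne'⟩ := Finset.exists_ne_zero_of_sum_ne_zero hne
      rw [mem_simClass hr] at hw'
      have hlw := hr.length_eq hw'
      obtain ⟨z, hz', hz⟩ := cell_inter_nonempty_of_sim hK hw'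
      have e1 := ih w' (by omega) (right_ne_zero_of_mul hne') (by omega) z hz'
      have e2 := hcell w z hz y (cell_append_subset hK w i hy)
      rw [hn] at e2
      have e3 : q ^ n * D = D / (1 - q) * q ^ n - D / (1 - q) * q ^ (n + 1) := by
        field_simp; ring
      linarith [dist_triangle x z y]
  refine (key y hy).trans (sub_le_self _ ?_)
  positivity

/-! ### The coding map -/

lemma exists_mem_cell_restrict (hK : F.IsAttractor K) (w : InfWord N) :
    ∃ x : K, ∀ n, (x : EuclideanSpace ℝ (Fin d)) ∈ F.cell K (w.restrict n) := by
  obtain ⟨x, hx⟩ := IsCompact.nonempty_iInter_of_sequence_nonempty_isCompact_isClosed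
    (fun n => F.cell K (w.restrict n))
    (fun n => by rw [InfWord.restrict_succ]; exact cell_append_subset hK _ _)
    (fun n => cell_nonempty hK _) (isCompact_cell hK _)
    (fun n => (isCompact_cell hK _).isClosed)
  rw [mem_iInter] at hx
  exact ⟨⟨x, by simpa [InfWord.restrict, cell, wordMap] using hx 0⟩, hx⟩

/-- The coding map `𝒲⋆ → K`: the unique point in the intersection of the cells of the prefixes. -/
noncomputable def coding (hK : F.IsAttractor K) (w : InfWord N) : K :=
  (exists_mem_cell_restrict hK w).choose

lemma coding_mem_cell (hK : F.IsAttractor K) (w : InfWord N) (n : ℕ) :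
    (coding hK w : EuclideanSpace ℝ (Fin d)) ∈ F.cell K (w.restrict n) :=
  (exists_mem_cell_restrict hK w).choose_spec n

lemma exists_dist_lt_of_mem_cell (hK : F.IsAttractor K) {ε : ℝ} (hε : 0 < ε) :
    ∃ L : ℕ, ∀ w : Word N, L ≤ w.length → ∀ x ∈ F.cell K w, ∀ y ∈ F.cell K w, dist x y < ε := by
  obtain ⟨q, D, h0, h1, hD, hcell⟩ := exists_dist_le_of_mem_cell hK
  have hlim : Tendsto (fun n : ℕ => q ^ n * D) atTop (𝓝 (0 * D)) :=
    (tendsto_pow_atTop_nhds_zero_of_lt_one h0 h1).mul_const _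
  rw [zero_mul] at hlim
  obtain ⟨L, hL⟩ := eventually_atTop.1 (hlim.eventually (gt_mem_nhds hε))
  exact ⟨L, fun w hw x hx y hy => (hcell w x hx y hy).trans_lt (hL _ hw)⟩

lemma coding_eq_of_forall_mem_cell (hK : F.IsAttractor K) (w : InfWord N) (x : K)
    (hx : ∀ n, (x : EuclideanSpace ℝ (Fin d)) ∈ F.cell K (w.restrict n)) : coding hK w = x := by
  refine eq_of_forall_dist_le fun ε hε => ?_
  obtain ⟨L, hL⟩ := exists_dist_lt_of_mem_cell hK hε
  exact (hL (w.restrict L) (by simp) _ (coding_mem_cell hK w L) _ (hx L)).le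

lemma continuous_coding (hK : F.IsAttractor K) : Continuous (coding hK) := by
  refine Metric.continuous_iff'.2 fun w ε hε => ?_
  obtain ⟨L, hL⟩ := exists_dist_lt_of_mem_cell hK hε
  filter_upwards [w.eventually_restrict_eq L] with v hv
  exact hL (w.restrict L) (by simp) _ (hv ▸ coding_mem_cell hK v L) _ (coding_mem_cell hK w L)

lemma coding_surjective (hK : F.IsAttractor K) : Function.Surjective (coding hK) := by
  have step : ∀ x : K, ∃ p : Fin N × K, F.S p.1 p.2 = (x : EuclideanSpace ℝ (Fin d)) := by
    rintro ⟨x, hx⟩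
    rw [hK.2.2.2, mem_iUnion] at hx
    obtain ⟨i, y, hy, hxy⟩ := hx
    exact ⟨(i, ⟨y, hy⟩), hxy⟩
  choose g hg using step
  intro x
  -- The letters of an address of `x` are read off its orbit under a chosen inverse branch.
  let orbit : ℕ → K := fun n => (fun y => (g y).2)^[n] x
  let w : InfWord N := fun n => (g (orbit n)).1
  have h : ∀ n, F.wordMap (w.restrict n) (orbit n) = (x : EuclideanSpace ℝ (Fin d)) := by
    intro n
    induction n with
    | zero => rfl
    | succ n ih =>
      rw [InfWord.restrict_succ, wordMap_append, Function.comp_apply]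
      have : orbit (n + 1) = (g (orbit n)).2 := Function.iterate_succ_apply' _ _ _
      rw [this]
      exact (congrArg _ (hg (orbit n))).trans ih
  exact ⟨w, coding_eq_of_forall_mem_cell hK w x fun n => ⟨orbit n, (orbit n).2, h n⟩⟩

lemma coding_eq_coding_iff (hK : F.IsAttractor K) (v w : InfWord N) :
    coding hK v = coding hK w ↔ InfSim (F.Sim K) v w := by
  constructor
  · intro h
    by_cases hvw : v = w
    · exact ⟨0, fun n _ => Or.inl (by rw [hvw])⟩
    obtain ⟨k, hk⟩ := Function.ne_iff.1 hvw
    -- From the second letter after the first difference on, the parents differ as well.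
    refine ⟨k + 2, fun n hn => Or.inr ⟨by simp, ⟨coding hK v, coding_mem_cell hK v n, ?_⟩, ?_⟩⟩
    · rw [h]; exact coding_mem_cell hK w n
    · obtain ⟨n, rfl⟩ := Nat.exists_eq_add_of_le' (show 1 ≤ n by omega)
      simp only [InfWord.restrict_succ, List.dropLast_concat, ne_eq]
      exact fun e => hk (InfWord.restrict_eq_restrict.1 e k (by omega))
  · rintro ⟨n₀, h⟩
    refine eq_of_forall_dist_le fun ε hε => ?_
    obtain ⟨L, hL⟩ := exists_dist_lt_of_mem_cell hK (half_pos hε)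
    obtain ⟨z, hz, hz'⟩ := cell_inter_nonempty_of_sim hK (h (max n₀ L) (le_max_left _ _))
    have e1 := hL _ (by simp) _ (coding_mem_cell hK v _) z hz
    have e2 := hL _ (by simp) z hz' _ (coding_mem_cell hK w _)
    rw [Subtype.dist_eq]
    linarith [dist_triangle (coding hK v : EuclideanSpace ℝ (Fin d)) z (coding hK w)]

/-- `𝒲⋆/∼ ≅ K` through the coding map. -/
lemma exists_homeomorph_quotient (hK : F.IsAttractor K) (hA : Equivalence (F.Sim K)) :
    ∃ Ψ : Quotient (infSetoid (F.Sim K) hA) ≃ₜ K, ∀ w, Ψ (Quotient.mk _ w) = coding hK w := by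
  let f : Quotient (infSetoid (F.Sim K) hA) → K :=
    Quotient.lift (coding hK) fun v w h => (coding_eq_coding_iff hK v w).2 h
  have hinj : Function.Injective f := by
    rintro ⟨v⟩ ⟨w⟩ h
    exact Quotient.sound ((coding_eq_coding_iff hK v w).1 h)
  have hsurj : Function.Surjective f := fun x =>
    let ⟨w, hw⟩ := coding_surjective hK x
    ⟨Quotient.mk _ w, hw⟩
  have hcont : Continuous f := (continuous_coding hK).quotient_lift _
  exact ⟨Continuous.homeoOfEquivCompactToT2 (f := Equiv.ofBijective f ⟨hinj, hsurj⟩) hcont,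
    fun _ => rfl⟩

end SimilitudeIFS

/-! ### The Martin metric -/

variable {a : Word N → ℝ}

/-- The weighted `ℓ¹` distance of two functions on words; the Martin metric is its pull-back along
`w ↦ k(·, w)`. -/
noncomputable def weightedDist (a f g : Word N → ℝ) : ℝ := ∑' u, a u * |f u - g u|

/-- The product of the intervals `[0, 1 / m(u)]`, which contains `k(·, w)` for every `w` and on which
`weightedDist` is a finite metric. -/
def kernelBox (m : Fin N → ℝ) : Set (Word N → ℝ) :=
  {f | ∀ u, f u ∈ Icc 0 (wordMass m u)⁻¹}

lemma summable_weight (hr : IsAdmissible r) (hm : IsMassDistribution m) (ha : IsMartinWeight r m a) :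
    Summable fun u => a u * (wordMass m u)⁻¹ := by
  refine ha.2.congr fun u => ?_
  rw [green_nil hr hm, div_eq_mul_inv]

lemma mul_abs_sub_le (ha : IsMartinWeight r m a) {f g : Word N → ℝ} (hf : f ∈ kernelBox m)
    (hg : g ∈ kernelBox m) (u : Word N) :
    a u * |f u - g u| ≤ a u * (wordMass m u)⁻¹ := by
  refine mul_le_mul_of_nonneg_left (abs_le.2 ?_) (ha.1 u).le
  constructor <;> linarith [(hf u).1, (hf u).2, (hg u).1, (hg u).2]

lemma mul_abs_sub_nonneg (ha : IsMartinWeight r m a) (f g : Word N → ℝ) (u : Word N) :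
    0 ≤ a u * |f u - g u| :=
  mul_nonneg (ha.1 u).le (abs_nonneg _)

lemma summable_weightedDist (hr : IsAdmissible r) (hm : IsMassDistribution m)
    (ha : IsMartinWeight r m a) {f g : Word N → ℝ} (hf : f ∈ kernelBox m)
    (hg : g ∈ kernelBox m) : Summable fun u => a u * |f u - g u| :=
  Summable.of_nonneg_of_le (mul_abs_sub_nonneg ha f g) (mul_abs_sub_le ha hf hg)
    (summable_weight hr hm ha)

lemma tendsto_weightedDist (hr : IsAdmissible r) (hm : IsMassDistribution m)
    (ha : IsMartinWeight r m a) {ι : Type*} {l : Filter ι} {f g : ι → Word N → ℝ}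
    {f₀ g₀ : Word N → ℝ} (hf : ∀ n, f n ∈ kernelBox m) (hg : ∀ n, g n ∈ kernelBox m)
    (hf₀ : ∀ u, Tendsto (fun n => f n u) l (𝓝 (f₀ u)))
    (hg₀ : ∀ u, Tendsto (fun n => g n u) l (𝓝 (g₀ u))) :
    Tendsto (fun n => weightedDist a (f n) (g n)) l (𝓝 (weightedDist a f₀ g₀)) := by
  refine tendsto_tsum_of_dominated_convergence (summable_weight hr hm ha)
    (fun u => ((hf₀ u).sub (hg₀ u)).abs.const_mul (a u)) (Eventually.of_forall fun n u => ?_)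
  rw [Real.norm_of_nonneg (mul_abs_sub_nonneg ha _ _ u)]
  exact mul_abs_sub_le ha (hf n) (hg n) u

lemma mul_abs_sub_le_weightedDist (hr : IsAdmissible r) (hm : IsMassDistribution m)
    (ha : IsMartinWeight r m a) {f g : Word N → ℝ} (hf : f ∈ kernelBox m)
    (hg : g ∈ kernelBox m) (u : Word N) : a u * |f u - g u| ≤ weightedDist a f g :=
  (summable_weightedDist hr hm ha hf hg).le_tsum u fun v _ => mul_abs_sub_nonneg ha f g v

lemma weightedDist_comm (a f g : Word N → ℝ) : weightedDist a f g = weightedDist a g f := by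
  simp only [weightedDist, abs_sub_comm]

lemma weightedDist_triangle (hr : IsAdmissible r) (hm : IsMassDistribution m)
    (ha : IsMartinWeight r m a) {f g h : Word N → ℝ} (hf : f ∈ kernelBox m)
    (hg : g ∈ kernelBox m) (hh : h ∈ kernelBox m) :
    weightedDist a f h ≤ weightedDist a f g + weightedDist a g h := by
  have h1 := summable_weightedDist hr hm ha hf hg
  have h2 := summable_weightedDist hr hm ha hg hh
  rw [weightedDist, weightedDist, weightedDist, ← h1.tsum_add h2]
  refine (summable_weightedDist hr hm ha hf hh).tsum_le_tsum (fun u => ?_) (h1.add h2)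
  rw [← mul_add]
  exact mul_le_mul_of_nonneg_left (abs_sub_le _ _ _) (ha.1 u).le

lemma martinDist_eq_weightedDist (r : Word N → Word N → Prop) (m : Fin N → ℝ) (a : Word N → ℝ)
    (v w : Word N) : martinDist r m a v w =
      weightedDist a (fun u => martinKernel r m u v) (fun u => martinKernel r m u w) := rfl

/-- Cauchy for the Martin metric means pointwise convergence of the kernels. -/
lemma mem_martinCauchy_iff (hr : IsAdmissible r) (hm : IsMassDistribution m)
    (ha : IsMartinWeight r m a) {s : ℕ → Word N} :
    s ∈ martinCauchy r m a ↔
      ∀ u, ∃ l : ℝ, Tendsto (fun n => martinKernel r m u (s n)) atTop (𝓝 l) := by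
  have hbox : ∀ n, (fun u => martinKernel r m u (s n)) ∈ kernelBox m :=
    fun n u => martinKernel_mem_Icc hr hm u _
  constructor
  · intro hs u
    refine cauchySeq_tendsto_of_complete (Metric.cauchySeq_iff.2 fun ε hε => ?_)
    obtain ⟨n₀, h⟩ := hs (a u * ε) (mul_pos (ha.1 u) hε)
    refine ⟨n₀, fun i hi j hj => ?_⟩
    have := (mul_abs_sub_le_weightedDist hr hm ha (hbox i) (hbox j) u).trans_lt (h i hi j hj)
    exact lt_of_mul_lt_mul_left this (ha.1 u).le
  · intro hs ε hε
    choose f hf using hs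
    have hfbox : f ∈ kernelBox m := fun u =>
      isClosed_Icc.mem_of_tendsto (hf u) (Eventually.of_forall fun n => hbox n u)
    have hlim := tendsto_weightedDist hr hm ha hbox (fun _ => hfbox) hf
      (fun u => tendsto_const_nhds)
    have h0 : weightedDist a f f = 0 := by simp [weightedDist]
    rw [h0] at hlim
    obtain ⟨n₀, h⟩ := eventually_atTop.1 (hlim.eventually (gt_mem_nhds (half_pos hε)))
    refine ⟨n₀, fun i hi j hj => ?_⟩
    have h1 := h i hi
    have h2 := h j hj
    rw [weightedDist_comm] at h2
    rw [martinDist_eq_weightedDist]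
    linarith [weightedDist_triangle hr hm ha (hbox i) hfbox (hbox j)]

lemma mem_martinClass_iff (hr : IsAdmissible r) (hm : IsMassDistribution m)
    (ha : IsMartinWeight r m a) {s t : ℕ → Word N} {f : Word N → ℝ}
    (hs : ∀ u, Tendsto (fun n => martinKernel r m u (s n)) atTop (𝓝 (f u))) :
    t ∈ martinClass r m a s ↔
      ∀ u, Tendsto (fun n => martinKernel r m u (t n)) atTop (𝓝 (f u)) := by
  constructor
  · rintro ⟨-, h⟩ u
    obtain ⟨l, h1, h2⟩ := h u
    rwa [tendsto_nhds_unique (hs u) h1]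
  · exact fun h => ⟨(mem_martinCauchy_iff hr hm ha).2 fun u => ⟨_, h u⟩,
      fun u => ⟨_, hs u, h u⟩⟩

lemma mem_martinClass_restrict_iff (hr : IsAdmissible r) (hm : IsMassDistribution m)
    (ha : IsMartinWeight r m a) {w : InfWord N} {t : ℕ → Word N} :
    t ∈ martinClass r m a w.restrict ↔
      ∀ u, Tendsto (fun n => martinKernel r m u (t n)) atTop (𝓝 (boundaryKernel r m u w)) :=
  mem_martinClass_iff hr hm ha fun u => tendsto_martinKernel_restrict hr hm u w

/-- A word and an infinite word are told apart by the kernels `k(u, ·)` with `|u| = |w₀| + 1`. -/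
lemma exists_boundaryKernel_ne_martinKernel (hr : IsAdmissible r) (hm : IsMassDistribution m)
    (w₀ : Word N) (w : InfWord N) : ∃ u, martinKernel r m u w₀ ≠ boundaryKernel r m u w := by
  classical
  obtain ⟨u, hu, hne⟩ := exists_boundaryKernel_ne_zero hr hm (w₀.length + 1) w
  refine ⟨u, ?_⟩
  rw [martinKernel_of_length_le hr hm (by omega), if_neg (by rintro rfl; omega)]
  exact hne.symm

/-! ### Points of the Martin boundary -/

lemma exists_frequently_eq_of_not_tendsto_length {s : ℕ → Word N}
    (hs : ¬ Tendsto (fun n => (s n).length) atTop atTop) : ∃ w, ∃ᶠ n in atTop, s n = w := by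
  by_contra! h
  refine hs (tendsto_atTop.2 fun L => ?_)
  have : ∀ᶠ n in atTop, ∀ w ∈ {w : Word N | w.length < L}, s n ≠ w :=
    (Filter.eventually_all_finite (List.finite_length_lt (Fin N) L)).2
      fun w _ => h w
  filter_upwards [this] with n hn
  by_contra! hlt
  exact hn _ hlt rfl

lemma eq_of_frequently_eq_of_tendsto {s : ℕ → Word N} {w : Word N} (h : ∃ᶠ n in atTop, s n = w)
    {u : Word N} {l : ℝ} (hl : Tendsto (fun n => martinKernel r m u (s n)) atTop (𝓝 l)) :
    martinKernel r m u w = l :=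
  isClosed_singleton.mem_of_frequently_of_tendsto (s := {martinKernel r m u w})
    (h.mono fun n hn => by simp [hn]) hl |>.symm

lemma tendsto_length_of_tendsto_boundaryKernel (hr : IsAdmissible r) (hm : IsMassDistribution m)
    {w : InfWord N} {t : ℕ → Word N}
    (ht : ∀ u, Tendsto (fun n => martinKernel r m u (t n)) atTop (𝓝 (boundaryKernel r m u w))) :
    Tendsto (fun n => (t n).length) atTop atTop := by
  by_contra h
  obtain ⟨w₀, hw₀⟩ := exists_frequently_eq_of_not_tendsto_length h
  obtain ⟨u, hu⟩ := exists_boundaryKernel_ne_martinKernel hr hm w₀ w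
  exact hu (eq_of_frequently_eq_of_tendsto hw₀ (ht u))

/-- An infinite word with prefix `t`. -/
noncomputable def extend [Nonempty (Fin N)] (t : Word N) : InfWord N :=
  (exists_restrict_eq t).choose

lemma restrict_extend [Nonempty (Fin N)] (t : Word N) : (extend t).restrict t.length = t :=
  (exists_restrict_eq t).choose_spec

lemma tendsto_martinKernel_sub_extend [Nonempty (Fin N)] (hr : IsAdmissible r)
    (hm : IsMassDistribution m) (u : Word N) {s : ℕ → Word N}
    (hs : Tendsto (fun n => (s n).length) atTop atTop) :
    Tendsto (fun n => martinKernel r m u (s n) - boundaryKernel r m u (extend (s n)))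
      atTop (𝓝 0) := by
  refine Metric.tendsto_nhds.2 fun ε hε => ?_
  obtain ⟨L, hL⟩ := exists_abs_martinKernel_sub_boundaryKernel_le hr hm u (half_pos hε)
  filter_upwards [hs.eventually_ge_atTop L] with n hn
  have := hL (s n) (extend (s n)) hn (by
    conv_lhs => rw [← restrict_extend (s n)]
    exact InfWord.take_restrict _ hn)
  rw [dist_zero_right, Real.norm_eq_abs]
  linarith

/-- The points of the Martin boundary are the classes of the prefix sequences of infinite words. -/
lemma mem_martinBoundarySet_iff [Nonempty (Fin N)] (hr : IsAdmissible r) (hm : IsMassDistribution m)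
    (ha : IsMartinWeight r m a) (ξ : Set (ℕ → Word N)) :
    ξ ∈ martinBoundarySet r m a ↔ ∃ w : InfWord N, ξ = martinClass r m a w.restrict := by
  constructor
  · rintro ⟨⟨s, hs, rfl⟩, hconst⟩
    have hs' := (mem_martinCauchy_iff hr hm ha).1 hs
    choose f hf using hs'
    -- Otherwise `s` takes one value infinitely often and represents that word.
    have hlen : Tendsto (fun n => (s n).length) atTop atTop := by
      by_contra h
      obtain ⟨w₀, hw₀⟩ := exists_frequently_eq_of_not_tendsto_length h
      refine hconst ⟨w₀, ?_⟩
      ext t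
      rw [mem_martinClass_iff hr hm ha hf, mem_martinClass_iff hr hm ha (f := f)]
      intro u
      rw [eq_of_frequently_eq_of_tendsto hw₀ (hf u)]
      exact tendsto_const_nhds
    -- Any cluster point of the words `s n`, extended to infinite words, represents the class.
    obtain ⟨w, φ, hφ, hw⟩ := CompactSpace.tendsto_subseq fun n => extend (s n)
    refine ⟨w, ?_⟩
    have hfw : f = fun u => boundaryKernel r m u w := by
      funext u
      have h1 := (tendsto_martinKernel_sub_extend hr hm u hlen).comp hφ.tendsto_atTop
      have h2 := ((continuous_boundaryKernel hr hm u).tendsto w).comp hw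
      have h3 := (hf u).comp hφ.tendsto_atTop
      refine tendsto_nhds_unique h3 ?_
      simpa [Function.comp_def] using h1.add h2
    ext t
    rw [mem_martinClass_iff hr hm ha hf, mem_martinClass_restrict_iff hr hm ha, hfw]
  · rintro ⟨w, rfl⟩
    refine ⟨⟨w.restrict, (mem_martinCauchy_iff hr hm ha).2
      fun u => ⟨_, tendsto_martinKernel_restrict hr hm u w⟩, rfl⟩, ?_⟩
    rintro ⟨w₀, hw₀⟩
    have h1 : (fun _ => w₀) ∈ martinClass r m a w.restrict := by
      rw [← show _ = martinClass r m a w.restrict from hw₀, mem_martinClass_iff hr hm ha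
        (f := fun u => martinKernel r m u w₀)] <;> exact fun u => tendsto_const_nhds
    rw [mem_martinClass_restrict_iff hr hm ha] at h1
    obtain ⟨u, hu⟩ := exists_boundaryKernel_ne_martinKernel hr hm w₀ w
    exact hu (tendsto_nhds_unique tendsto_const_nhds (h1 u))

lemma mem_martinBall_iff (hr : IsAdmissible r) (hm : IsMassDistribution m)
    (ha : IsMartinWeight r m a) {ξ ζ : MartinBoundary r m a} {v w : InfWord N}
    (hξ : ξ.1 = martinClass r m a v.restrict) (hζ : ζ.1 = martinClass r m a w.restrict) (ε : ℝ) :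
    ζ ∈ martinBall r m a ξ ε ↔
      weightedDist a (fun u => boundaryKernel r m u v) (fun u => boundaryKernel r m u w) < ε := by
  have hlim : ∀ s ∈ ξ.1, ∀ t ∈ ζ.1, Tendsto (fun n => martinDist r m a (s n) (t n)) atTop
      (𝓝 (weightedDist a (fun u => boundaryKernel r m u v) fun u => boundaryKernel r m u w)) := by
    intro s hs t ht
    rw [hξ, mem_martinClass_restrict_iff hr hm ha] at hs
    rw [hζ, mem_martinClass_restrict_iff hr hm ha] at ht
    exact tendsto_weightedDist hr hm ha (fun n u => martinKernel_mem_Icc hr hm u _)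
      (fun n u => martinKernel_mem_Icc hr hm u _) hs ht
  have hself : ∀ w : InfWord N, w.restrict ∈ martinClass r m a w.restrict := fun w =>
    (mem_martinClass_restrict_iff hr hm ha).2 fun u => tendsto_martinKernel_restrict hr hm u w
  constructor
  · rintro ⟨s, hs, t, ht, l, hl, h⟩
    rwa [tendsto_nhds_unique (hlim s hs t ht) h]
  · intro h
    refine ⟨v.restrict, hξ ▸ hself v, w.restrict, hζ ▸ hself w, _, h, hlim _ ?_ _ ?_⟩
    exacts [hξ ▸ hself v, hζ ▸ hself w]

lemma boundaryKernel_mem_kernelBox (hr : IsAdmissible r) (hm : IsMassDistribution m)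
    (w : InfWord N) : (fun u => boundaryKernel r m u w) ∈ kernelBox m :=
  fun u => boundaryKernel_mem_Icc hr hm u w

/-! ### The topology of the Martin boundary -/

lemma t2Space_martinBoundary [Nonempty (Fin N)] (hr : IsAdmissible r) (hm : IsMassDistribution m)
    (ha : IsMartinWeight r m a) : T2Space (MartinBoundary r m a) := by
  refine ⟨fun ξ ζ hne => ?_⟩
  obtain ⟨v, hv⟩ := (mem_martinBoundarySet_iff hr hm ha ξ.1).1 ξ.2
  obtain ⟨w, hw⟩ := (mem_martinBoundarySet_iff hr hm ha ζ.1).1 ζ.2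
  have hbv := boundaryKernel_mem_kernelBox hr hm v
  have hbw := boundaryKernel_mem_kernelBox hr hm w
  set f := fun u => boundaryKernel r m u v with hf
  set g := fun u => boundaryKernel r m u w with hg
  have hpos : 0 < weightedDist a f g := by
    by_contra! hle
    refine hne (Subtype.ext ?_)
    have hfg : f = g := by
      funext u
      have h1 := (mul_abs_sub_le_weightedDist hr hm ha hbv hbw u).trans hle
      have h2 : |f u - g u| ≤ 0 := nonpos_of_mul_nonpos_right h1 (ha.1 u)
      exact sub_eq_zero.1 (abs_nonpos_iff.1 h2)
    rw [hv, hw]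
    ext t
    rw [mem_martinClass_restrict_iff hr hm ha, mem_martinClass_restrict_iff hr hm ha]
    exact forall_congr' fun u => by rw [show boundaryKernel r m u v = _ from congrFun hfg u]
  have hopen : ∀ η : MartinBoundary r m a,
      IsOpen (martinBall r m a η (weightedDist a f g / 2)) := fun η =>
    TopologicalSpace.isOpen_generateFrom_of_mem ⟨η, _, half_pos hpos, rfl⟩
  have hzero : ∀ h : Word N → ℝ, weightedDist a h h = 0 := fun h => by simp [weightedDist]
  refine ⟨_, _, hopen ξ, hopen ζ, ?_, ?_, Set.disjoint_left.2 fun η h1 h2 => ?_⟩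
  · rw [mem_martinBall_iff hr hm ha hv hv, hzero]; exact half_pos hpos
  · rw [mem_martinBall_iff hr hm ha hw hw, hzero]; exact half_pos hpos
  · obtain ⟨x, hx⟩ := (mem_martinBoundarySet_iff hr hm ha η.1).1 η.2
    rw [mem_martinBall_iff hr hm ha hv hx] at h1
    rw [mem_martinBall_iff hr hm ha hw hx, weightedDist_comm] at h2
    linarith [weightedDist_triangle hr hm ha hbv (boundaryKernel_mem_kernelBox hr hm x) hbw]

/-- The boundary point of an infinite word `w`: the class of its prefix sequence. -/
noncomputable def boundaryPoint [Nonempty (Fin N)] (hr : IsAdmissible r) (hm : IsMassDistribution m)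
    (ha : IsMartinWeight r m a) (w : InfWord N) : MartinBoundary r m a :=
  ⟨martinClass r m a w.restrict, (mem_martinBoundarySet_iff hr hm ha _).2 ⟨w, rfl⟩⟩

lemma continuous_boundaryPoint [Nonempty (Fin N)] (hr : IsAdmissible r) (hm : IsMassDistribution m)
    (ha : IsMartinWeight r m a) : Continuous (boundaryPoint hr hm ha) := by
  refine continuous_generateFrom_iff.2 ?_
  rintro _ ⟨ξ, ε, -, rfl⟩
  obtain ⟨v, hv⟩ := (mem_martinBoundarySet_iff hr hm ha ξ.1).1 ξ.2
  have hpre : boundaryPoint hr hm ha ⁻¹' martinBall r m a ξ ε =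
      {w | weightedDist a (fun u => boundaryKernel r m u v)
        (fun u => boundaryKernel r m u w) < ε} := by
    ext w
    exact mem_martinBall_iff hr hm ha hv rfl ε
  rw [hpre]
  refine isOpen_lt (continuous_iff_continuousAt.2 fun w => ?_) continuous_const
  exact tendsto_weightedDist hr hm ha (fun _ => boundaryKernel_mem_kernelBox hr hm v)
    (fun w => boundaryKernel_mem_kernelBox hr hm w) (fun _ => tendsto_const_nhds)
    (fun u => (continuous_boundaryKernel hr hm u).continuousAt)

/-! ### Comparison with the attractor -/

namespace SimilitudeIFS

variable {d : ℕ} {F : SimilitudeIFS d N} {K : Set (EuclideanSpace ℝ (Fin d))}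

/-- If the kernels along `t` converge to those of `w`, then the cells of `t` shrink to the point
coded by `w`: some `u` of a high level has `k(u, w) ≠ 0`, and both the cells of `t` and the point
are near the cell of this `u`. -/
lemma eventually_dist_coding_lt (hK : F.IsAttractor K) (hA : Equivalence (F.Sim K))
    (hm : IsMassDistribution m) {w : InfWord N} {t : ℕ → Word N}
    (ht : ∀ u, Tendsto (fun n => martinKernel (F.Sim K) m u (t n)) atTop
      (𝓝 (boundaryKernel (F.Sim K) m u w))) {ε : ℝ} (hε : 0 < ε) :
    ∀ᶠ n in atTop, ∀ x ∈ F.cell K (t n), dist x (coding hK w) < ε := by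
  have hr := isAdmissible_sim hK hA
  obtain ⟨q, C, h0, h1, h⟩ := exists_dist_le_of_martinKernel_ne_zero hK hA hm
  have hlim : Tendsto (fun n : ℕ => C * q ^ n) atTop (𝓝 (C * 0)) :=
    (tendsto_pow_atTop_nhds_zero_of_lt_one h0 h1).const_mul _
  rw [mul_zero] at hlim
  obtain ⟨k, hk⟩ := (hlim.eventually (gt_mem_nhds (half_pos hε))).exists
  obtain ⟨u, hu, hne⟩ := exists_boundaryKernel_ne_zero hr hm k w
  obtain ⟨z, hz⟩ := cell_nonempty (F := F) hK u
  have hw : dist z (coding hK w) ≤ C * q ^ k := by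
    obtain ⟨n, hn, hn'⟩ := ((tendsto_martinKernel_restrict hr hm u w).eventually_ne hne).and
      (eventually_ge_atTop u.length) |>.exists
    exact hu ▸ h u _ (by simpa using hn') hn z hz _ (coding_mem_cell hK w n)
  filter_upwards [(ht u).eventually_ne hne,
    (tendsto_length_of_tendsto_boundaryKernel hr hm ht).eventually_ge_atTop u.length]
    with n hn hn' x hx
  have hx' := hu ▸ h u _ hn' hn z hz x hx
  linarith [dist_triangle_left x (coding hK w : EuclideanSpace ℝ (Fin d)) z]

/-- The class of an infinite word in terms of the attractor alone.  In particular it depends neither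
on the mass distribution nor on the coefficients of the metric. -/
lemma mem_martinClass_restrict_iff_cell [Nonempty (Fin N)] (hK : F.IsAttractor K)
    (hA : Equivalence (F.Sim K)) (hm : IsMassDistribution m)
    (ha : IsMartinWeight (F.Sim K) m a) (w : InfWord N) (t : ℕ → Word N) :
    t ∈ martinClass (F.Sim K) m a w.restrict ↔
      Tendsto (fun n => (t n).length) atTop atTop ∧
        ∀ ε > 0, ∀ᶠ n in atTop, ∀ x ∈ F.cell K (t n), dist x (coding hK w) < ε := by
  have hr := isAdmissible_sim hK hA
  rw [mem_martinClass_restrict_iff hr hm ha]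
  constructor
  · exact fun h => ⟨tendsto_length_of_tendsto_boundaryKernel hr hm h,
      fun ε hε => eventually_dist_coding_lt hK hA hm h hε⟩
  · rintro ⟨hlen, hcell⟩ u
    obtain ⟨Ψ, hΨ⟩ := exists_homeomorph_quotient hK hA
    -- `k(u, ·)` is a continuous function of the coded point because `K` is the quotient `𝒲⋆/∼`.
    let κ : Quotient (infSetoid (F.Sim K) hA) → ℝ :=
      Quotient.lift (boundaryKernel (F.Sim K) m u)
        fun v w h => boundaryKernel_eq_of_infSim hr hm h u
    have hκ : Continuous κ := (continuous_boundaryKernel hr hm u).quotient_lift _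
    have hκ' : ∀ v, boundaryKernel (F.Sim K) m u v = κ (Ψ.symm (coding hK v)) := fun v => by
      rw [← hΨ, Homeomorph.symm_apply_apply]; rfl
    have hcod : Tendsto (fun n => coding hK (extend (t n))) atTop (𝓝 (coding hK w)) := by
      refine Metric.tendsto_nhds.2 fun ε hε => ?_
      filter_upwards [hcell ε hε] with n hn
      have := coding_mem_cell hK (extend (t n)) (t n).length
      rw [restrict_extend] at this
      exact hn _ this
    have h1 := ((hκ.comp Ψ.symm.continuous).tendsto _).comp hcod
    have h2 := tendsto_martinKernel_sub_extend hr hm u hlen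
    have h3 := h2.add h1
    simp only [Function.comp_def, ← hκ', sub_add_cancel, zero_add] at h3
    exact h3

/-- `𝒲⋆/∼ ≅ 𝓜`: a continuous bijection from a compact space to a Hausdorff space. -/
lemma exists_homeomorph_martinBoundary [Nonempty (Fin N)] (hK : F.IsAttractor K)
    (hA : Equivalence (F.Sim K)) (hm : IsMassDistribution m)
    (ha : IsMartinWeight (F.Sim K) m a) :
    ∃ Θ : Quotient (infSetoid (F.Sim K) hA) ≃ₜ MartinBoundary (F.Sim K) m a,
      ∀ w, (Θ (Quotient.mk _ w)).1 = martinClass (F.Sim K) m a w.restrict := by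
  have hr := isAdmissible_sim hK hA
  have := t2Space_martinBoundary hr hm ha
  let f : Quotient (infSetoid (F.Sim K) hA) → MartinBoundary (F.Sim K) m a :=
    Quotient.lift (boundaryPoint hr hm ha) fun v w h => Subtype.ext <| by
      ext t
      refine (mem_martinClass_restrict_iff hr hm ha).trans
        (Iff.trans (forall_congr' fun u => ?_) (mem_martinClass_restrict_iff hr hm ha).symm)
      rw [boundaryKernel_eq_of_infSim hr hm h u]
  have hinj : Function.Injective f := by
    rintro ⟨v⟩ ⟨w⟩ h
    refine Quotient.sound ((coding_eq_coding_iff hK v w).1 ?_)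
    have hv : v.restrict ∈ martinClass (F.Sim K) m a w.restrict := by
      rw [← show martinClass (F.Sim K) m a v.restrict = martinClass (F.Sim K) m a w.restrict from
        congrArg Subtype.val h, mem_martinClass_restrict_iff hr hm ha]
      exact fun u => tendsto_martinKernel_restrict hr hm u v
    rw [mem_martinClass_restrict_iff_cell hK hA hm ha] at hv
    refine eq_of_forall_dist_le fun ε hε => ?_
    obtain ⟨n, hn⟩ := (hv.2 ε hε).exists
    exact (hn _ (coding_mem_cell hK v n)).le
  have hsurj : Function.Surjective f := fun ξ =>
    let ⟨w, hw⟩ := (mem_martinBoundarySet_iff hr hm ha ξ.1).1 ξ.2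
    ⟨Quotient.mk _ w, Subtype.ext hw.symm⟩
  have hcont : Continuous f := (continuous_boundaryPoint hr hm ha).quotient_lift _
  exact ⟨Continuous.homeoOfEquivCompactToT2 (f := Equiv.ofBijective f ⟨hinj, hsurj⟩) hcont,
    fun _ => rfl⟩

end SimilitudeIFS

/-- `m(a) < 1` forces at least two letters, so that `1 / N < 1`. -/
lemma isMassDistribution_homMass (hm : IsMassDistribution m) : IsMassDistribution (homMass N) := by
  have hN : 1 < N := by
    by_contra! h
    interval_cases N
    · simpa using hm.2
    · have := hm.2
      simp only [Fin.sum_univ_one] at this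
      exact (hm.1 0).2.ne this
  have hN' : (1 : ℝ) < N := by exact_mod_cast hN
  refine ⟨fun i => ⟨by unfold homMass; positivity, ?_⟩, ?_⟩
  · rw [homMass, div_lt_one (by positivity)]; exact hN'
  · simp only [homMass, Finset.sum_const, Finset.card_univ, Fintype.card_fin, nsmul_eq_mul]
    field_simp

end FractalMartin

open FractalMartin in
theorem mainTheorem2 {d N : ℕ} (F : SimilitudeIFS d N)
    (K : Set (EuclideanSpace ℝ (Fin d))) (hK : F.IsAttractor K) (hconn : IsConnected K)
    (hosc : F.OpenSetCondition) (hA : Equivalence (F.Sim K))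
    (m : Fin N → ℝ) (hm : IsMassDistribution m) (hB2 : ConditionB2 (F.Sim K) m)
    (a : Word N → ℝ) (ha : IsMartinWeight (F.Sim K) m a)
    (a_hom : Word N → ℝ) (ha_hom : IsMartinWeight (F.Sim K) (homMass N) a_hom) :
    Nonempty (K ≃ₜ Quotient (infSetoid (F.Sim K) hA)) ∧
    Nonempty (Quotient (infSetoid (F.Sim K) hA) ≃ₜ
      MartinBoundary (F.Sim K) (homMass N) a_hom) ∧
    martinBoundarySet (F.Sim K) (homMass N) a_hom = martinBoundarySet (F.Sim K) m a ∧
    (∃ Φ : MartinBoundary (F.Sim K) (homMass N) a_hom ≃ₜ MartinBoundary (F.Sim K) m a,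
      ∀ ξ, (Φ ξ).1 = ξ.1) ∧
    Nonempty (K ≃ₜ MartinBoundary (F.Sim K) m a) := by
  have hm' := isMassDistribution_homMass hm
  have : Nonempty (Fin N) := by
    by_contra h
    rw [not_nonempty_iff] at h
    simpa using hm.2
  have hr := SimilitudeIFS.isAdmissible_sim hK hA
  obtain ⟨Ψ, -⟩ := SimilitudeIFS.exists_homeomorph_quotient hK hA
  obtain ⟨Θ, hΘ⟩ := SimilitudeIFS.exists_homeomorph_martinBoundary hK hA hm ha
  obtain ⟨Θ', hΘ'⟩ := SimilitudeIFS.exists_homeomorph_martinBoundary hK hA hm' ha_hom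
  have hclass : ∀ w : InfWord N, martinClass (F.Sim K) (homMass N) a_hom w.restrict =
      martinClass (F.Sim K) m a w.restrict := by
    intro w
    ext t
    rw [SimilitudeIFS.mem_martinClass_restrict_iff_cell hK hA hm ha,
      SimilitudeIFS.mem_martinClass_restrict_iff_cell hK hA hm' ha_hom]
  refine ⟨⟨Ψ.symm⟩, ⟨Θ'⟩, ?_, ⟨Θ'.symm.trans Θ, fun ξ => ?_⟩, ⟨Ψ.symm.trans Θ⟩⟩
  · ext ξ
    rw [mem_martinBoundarySet_iff hr hm' ha_hom, mem_martinBoundarySet_iff hr hm ha]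
    simp only [hclass]
  · obtain ⟨x, rfl⟩ := Θ'.surjective ξ
    induction x using Quotient.inductionOn with
    | _ w =>
      rw [hΘ', Homeomorph.trans_apply, Homeomorph.symm_apply_apply, hΘ, hclass]
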